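/- Let $m\in\mathbb{N}$ and let $\ell_\infty^m=(\mathbb{C}^m,\|\cdot\|_\infty)$, where $\|x\|_\infty=\max_{k}|x_k|$. Write $S(Z)=\{z\in Z:\|z\|=1\}$ for the unit sphere of a normed space $Z$. The complex space $\ell_\infty^m$ has the Mazur–Ulam property: for every complex Banach space $X$ and every surjective isometry $\Delta:S(\ell_\infty^m)\to S(X)$ (with respect to the norm distances) there is exactly one surjective real-linear isometry $F:\ell_\infty^m\to X$ with $F(x)=\Delta(x)$ for all $x\in S(\ell_\infty^m)$. In particular, whenever such a $\Delta$ exists, $X$ is isometrically isomorphic to $\ell_\infty^m$ as a complex Banach space (by a complex-linear surjective isometry). -/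

import Mathlib

universe u v

/-- The complex normed space `Z` has the Mazur–Ulam property: for every complex Banach space `Y`,
every surjective isometry from the unit sphere of `Z` onto the unit sphere of `Y` is the restriction
of exactly one surjective real linear isometry from `Z` onto `Y`. -/
def HasMazurUlamProperty (Z : Type u) [NormedAddCommGroup Z] [NormedSpace ℂ Z] : Prop :=
  ∀ (Y : Type v) [NormedAddCommGroup Y] [NormedSpace ℂ Y] [CompleteSpace Y]
    (Δ : Metric.sphere (0 : Z) 1 → Metric.sphere (0 : Y) 1),
    Isometry Δ → Function.Surjective Δ →
      ∃! F : Z ≃ₗᵢ[ℝ] Y, ∀ z : Metric.sphere (0 : Z) 1, F (z : Z) = (Δ z : Y)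

/-! Call the unit vectors `y` of `X` with `D.invFun y k = c`, for unimodular `c`, the facet `(k,
c)`. In the supremum norm, unit vectors are at distance 2 exactly when some coordinate is unimodular
and changes sign. Hence facets are metric objects, negation sends `(k, c)` to `(k, -c)`, and `‖y +
z‖ = 2` exactly when `y` and `z` share a facet. Near its vertex a facet is convex, so Hahn–Banach
gives a contractive complex functional `f` equal to 1 on it (`exists_support`). Unimodular scalars
permute the facets of each direction (`exists_smul_facet_eq_same`), so `f = u` on `(k, τ u)`, with
`τ` an isometry of the circle fixing 1: the identity or conjugation. Comparing distances to these
facets identifies `f` with the `k`-th coordinate, up to conjugation (`exists_coordinate`). Together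
these functionals form a complex isometry onto `ι → ℂ`. -/

section ComplexPlane

open ComplexConjugate

/-! ### Geometry of the unit circle -/

theorem Complex.norm_sq_eq_re_sq_add_im_sq (z : ℂ) : ‖z‖ ^ 2 = z.re ^ 2 + z.im ^ 2 := by
  rw [Complex.sq_norm, Complex.normSq_apply]; ring

/-- Points of the closed unit disc are determined by their distances to the unit circle. -/
theorem Complex.eq_of_forall_norm_sub_le {w z : ℂ} (hw : ‖w‖ ≤ 1) (hz : ‖z‖ ≤ 1)
    (h : ∀ u : ℂ, ‖u‖ = 1 → ‖u - w‖ ≤ ‖u - z‖) : w = z := by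
  by_contra hne
  have hpos : 0 < ‖z - w‖ := norm_pos_iff.2 (sub_ne_zero.2 (Ne.symm hne))
  have key : ∀ u : ℂ, ‖u‖ = 1 →
      2 * (u.re * (z.re - w.re) + u.im * (z.im - w.im)) ≤ ‖z‖ ^ 2 - ‖w‖ ^ 2 := by
    intro u hu
    have h1 := pow_le_pow_left₀ (norm_nonneg _) (h u hu) 2
    rw [Complex.norm_sq_eq_re_sq_add_im_sq, Complex.norm_sq_eq_re_sq_add_im_sq] at h1
    rw [Complex.norm_sq_eq_re_sq_add_im_sq, Complex.norm_sq_eq_re_sq_add_im_sq]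
    simp only [Complex.sub_re, Complex.sub_im] at h1
    nlinarith
  -- In this extremal direction `key` reads `2‖z - w‖ ≤ ‖z‖² - ‖w‖²`, which forces `‖z‖ = 1`; then
  -- `u = z` is admissible in `h`.
  have hu : ‖(z - w) / (‖z - w‖ : ℂ)‖ = 1 := by
    rw [norm_div, Complex.norm_real, norm_norm, div_self hpos.ne']
  have h1 := key _ hu
  rw [Complex.div_ofReal_re, Complex.div_ofReal_im] at h1
  have h2 : ‖z - w‖ ^ 2 = (z.re - w.re) ^ 2 + (z.im - w.im) ^ 2 := by
    rw [Complex.norm_sq_eq_re_sq_add_im_sq, Complex.sub_re, Complex.sub_im]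
  have h3 : (z - w).re / ‖z - w‖ * (z.re - w.re) + (z - w).im / ‖z - w‖ * (z.im - w.im)
      = ‖z - w‖ := by
    rw [div_mul_eq_mul_div, div_mul_eq_mul_div, ← add_div, div_eq_iff hpos.ne', ← sq, h2,
      Complex.sub_re, Complex.sub_im]
    ring
  rw [h3] at h1
  have h4 : ‖z‖ - ‖w‖ ≤ ‖z - w‖ := norm_sub_norm_le _ _
  have hz1 : ‖z‖ = 1 := by
    refine le_antisymm hz ?_
    by_contra hlt
    push Not at hlt
    nlinarith [norm_nonneg z, norm_nonneg w]
  have h5 := h z hz1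
  rw [sub_self, norm_zero] at h5
  linarith

/-- An isometry of the unit circle that fixes `1` is the identity or the conjugation. -/
theorem Complex.circle_isometry_eq_id_or_conj (τ : ℂ → ℂ) (hτ : ∀ u, ‖u‖ = 1 → ‖τ u‖ = 1)
    (hd : ∀ u v, ‖u‖ = 1 → ‖v‖ = 1 → ‖τ u - τ v‖ = ‖u - v‖) (h1 : τ 1 = 1) :
    (∀ u, ‖u‖ = 1 → τ u = u) ∨ (∀ u, ‖u‖ = 1 → τ u = conj u) := by
  have sqn : ∀ u : ℂ, ‖u‖ = 1 → u.re ^ 2 + u.im ^ 2 = 1 := fun u hu => by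
    rw [← Complex.norm_sq_eq_re_sq_add_im_sq, hu, one_pow]
  have key : ∀ u v, ‖u‖ = 1 → ‖v‖ = 1 →
      (τ u).re * (τ v).re + (τ u).im * (τ v).im = u.re * v.re + u.im * v.im := by
    intro u v hu hv
    have h := congrArg (· ^ 2) (hd u v hu hv)
    simp only [Complex.norm_sq_eq_re_sq_add_im_sq, Complex.sub_re, Complex.sub_im] at h
    nlinarith [sqn u hu, sqn v hv, sqn _ (hτ u hu), sqn _ (hτ v hv)]
  have hre : ∀ u, ‖u‖ = 1 → (τ u).re = u.re := by
    intro u hu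
    have := key u 1 hu norm_one
    rw [h1] at this
    simpa using this
  have hI : (τ Complex.I).re = 0 := by rw [hre _ Complex.norm_I, Complex.I_re]
  have hI2 := sqn _ (hτ _ Complex.norm_I)
  rw [hI] at hI2
  have him : ∀ u, ‖u‖ = 1 → (τ u).im * (τ Complex.I).im = u.im := by
    intro u hu
    have := key u Complex.I hu Complex.norm_I
    rw [hI] at this
    simpa using this
  rcases sq_eq_one_iff.1 (show (τ Complex.I).im ^ 2 = 1 by linarith) with h | h
  · left
    intro u hu
    have := him u hu
    rw [h, mul_one] at this
    exact Complex.ext (hre u hu) this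
  · right
    intro u hu
    have := him u hu
    rw [h] at this
    refine Complex.ext ?_ ?_
    · rw [Complex.conj_re, hre u hu]
    · rw [Complex.conj_im]; linarith

end ComplexPlane

/-! ### Points at distance 2 in the supremum norm -/

section Faces

/-- The combination and its swap sum to a vector of norm `2 * (a + b)`, while each has norm at most
`a + b`. -/
theorem norm_smul_add_smul_of_norm_add_eq_two {X : Type*} [NormedAddCommGroup X] [NormedSpace ℝ X]
    {q r : X} (hq : ‖q‖ = 1) (hr : ‖r‖ = 1) (hqr : ‖q + r‖ = 2) {a b : ℝ} (ha : 0 ≤ a)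
    (hb : 0 ≤ b) : ‖a • q + b • r‖ = a + b := by
  have upper : ∀ {c d : ℝ}, 0 ≤ c → 0 ≤ d → ‖c • q + d • r‖ ≤ c + d := fun {c d} hc hd => by
    refine (norm_add_le _ _).trans ?_
    rw [norm_smul_of_nonneg hc, norm_smul_of_nonneg hd, hq, hr, mul_one, mul_one]
  refine le_antisymm (upper ha hb) ?_
  have h1 : (a • q + b • r) + (b • q + a • r) = (a + b) • (q + r) := by module
  have h2 := norm_add_le (a • q + b • r) (b • q + a • r)
  rw [h1, norm_smul_of_nonneg (add_nonneg ha hb), hqr] at h2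
  linarith [upper hb ha]

variable {ι : Type*} [Fintype ι]

theorem exists_norm_apply_eq_one {x : ι → ℂ} (hx : ‖x‖ = 1) : ∃ j, ‖x j‖ = 1 := by
  by_contra h
  push Not at h
  have : ‖x‖ < 1 := (pi_norm_lt_iff one_pos).2 fun j =>
    lt_of_le_of_ne (hx ▸ norm_le_pi_norm x j) (h j)
  exact this.ne hx

theorem norm_sub_eq_two_iff {x z : ι → ℂ} (hx : ‖x‖ = 1) (hz : ‖z‖ = 1) :
    ‖x - z‖ = 2 ↔ ∃ j, z j = -x j ∧ ‖x j‖ = 1 := by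
  have hx' := fun j => hx ▸ norm_le_pi_norm x j
  have hz' := fun j => hz ▸ norm_le_pi_norm z j
  have hle : ‖x - z‖ ≤ 2 := (norm_sub_le x z).trans (by rw [hx, hz]; norm_num)
  constructor
  · intro h
    by_contra hne
    push Not at hne
    refine ne_of_lt ((pi_norm_lt_iff (by norm_num)).2 fun j => ?_) h
    refine lt_of_le_of_ne ((norm_le_pi_norm (x - z) j).trans hle) fun hj => ?_
    rw [Pi.sub_apply] at hj
    have h1 := norm_sub_le (x j) (z j)
    have hxj : ‖x j‖ = 1 := by linarith [hx' j, hz' j]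
    have hzj : ‖z j‖ = 1 := by linarith [hx' j, hz' j]
    refine hne j ?_ hxj
    have e : SameRay ℝ (x j) (-z j) := by
      rw [sameRay_iff_norm_add, ← sub_eq_add_neg, hj, norm_neg, hxj, hzj]; norm_num
    rw [eq_neg_iff_add_eq_zero, add_comm, ← eq_neg_iff_add_eq_zero]
    exact (sameRay_iff_of_norm_eq (by rw [norm_neg, hxj, hzj])).1 e
  · rintro ⟨j, hj, hj1⟩
    refine le_antisymm hle ?_
    have := norm_le_pi_norm (x - z) j
    rw [Pi.sub_apply, hj, sub_neg_eq_add, ← two_mul, norm_mul, hj1] at this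
    simpa using this

theorem eq_of_pi_single_norm_eq_one {ι : Type*} [DecidableEq ι] {k j : ι} {c : ℂ}
    (h : ‖(Pi.single k c : ι → ℂ) j‖ = 1) : j = k := by
  by_contra hne
  rw [Pi.single_eq_of_ne hne, norm_zero] at h
  exact zero_ne_one h

end Faces

/-- A surjective isometry between the unit spheres of `ι → ℂ` (with the supremum norm) and of `X`,
given by a pair of mutually inverse functions whose values outside the spheres are irrelevant. -/
structure SphereIsometry (ι : Type*) [Fintype ι] (X : Type*) [NormedAddCommGroup X] where
  /-- the isometry -/
  toFun : (ι → ℂ) → X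
  /-- its inverse -/
  invFun : X → ι → ℂ
  norm_toFun : ∀ x, ‖x‖ = 1 → ‖toFun x‖ = 1
  norm_invFun : ∀ y, ‖y‖ = 1 → ‖invFun y‖ = 1
  left_inv : ∀ x, ‖x‖ = 1 → invFun (toFun x) = x
  right_inv : ∀ y, ‖y‖ = 1 → toFun (invFun y) = y
  norm_invFun_sub : ∀ y z, ‖y‖ = 1 → ‖z‖ = 1 → ‖invFun y - invFun z‖ = ‖y - z‖

/-! ### Facets of the sphere of `X` -/

namespace SphereIsometry

open ComplexConjugate

variable {ι : Type*} [Fintype ι] [DecidableEq ι] {X : Type*} [NormedAddCommGroup X]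
  (D : SphereIsometry ι X)

/-- The image of a unimodular multiple of a coordinate vector. -/
def vertex (k : ι) (c : ℂ) : X := D.toFun (Pi.single k c)

variable {D}

theorem norm_vertex {k : ι} {c : ℂ} (hc : ‖c‖ = 1) : ‖D.vertex k c‖ = 1 :=
  D.norm_toFun _ (by rw [Pi.norm_single, hc])

theorem invFun_vertex {k : ι} {c : ℂ} (hc : ‖c‖ = 1) : D.invFun (D.vertex k c) = Pi.single k c :=
  D.left_inv _ (by rw [Pi.norm_single, hc])

omit [DecidableEq ι] in
theorem norm_sub_eq_two_iff {y z : X} (hy : ‖y‖ = 1) (hz : ‖z‖ = 1) :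
    ‖y - z‖ = 2 ↔ ∃ j, D.invFun z j = -D.invFun y j ∧ ‖D.invFun y j‖ = 1 := by
  rw [← D.norm_invFun_sub y z hy hz,
    _root_.norm_sub_eq_two_iff (D.norm_invFun y hy) (D.norm_invFun z hz)]

theorem norm_vertex_sub_eq_two_iff {k : ι} {c : ℂ} (hc : ‖c‖ = 1) {z : X} (hz : ‖z‖ = 1) :
    ‖D.vertex k c - z‖ = 2 ↔ D.invFun z k = -c := by
  rw [norm_sub_eq_two_iff (D := D) (norm_vertex hc) hz, invFun_vertex hc]
  constructor
  · rintro ⟨j, h1, h2⟩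
    obtain rfl := eq_of_pi_single_norm_eq_one h2
    rw [h1, Pi.single_eq_same]
  · intro h
    exact ⟨k, by rw [h, Pi.single_eq_same], by rw [Pi.single_eq_same, hc]⟩

variable [NormedSpace ℂ X]

/-- The isometry maps antipodal facets to antipodal facets. -/
theorem invFun_neg_apply {y : X} (hy : ‖y‖ = 1) {k : ι} (hk : ‖D.invFun y k‖ = 1) :
    D.invFun (-y) k = -D.invFun y k := by
  set c := D.invFun y k with hc
  have hp : ‖D.vertex k c‖ = 1 := norm_vertex hk
  -- The vertex and its negative are at distance 2. The vector `y` is then at distance 2 from the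
  -- negated vertex, hence `-y` from the vertex.
  have h1 : D.invFun (-D.vertex k c) k = -c := by
    rw [← norm_vertex_sub_eq_two_iff hk (by rwa [norm_neg]), sub_neg_eq_add, ← two_smul ℂ,
      norm_smul, hp]
    norm_num
  have h2 : ‖y - -D.vertex k c‖ = 2 :=
    (norm_sub_eq_two_iff (D := D) hy (by rwa [norm_neg])).2 ⟨k, h1, hk⟩
  rw [← norm_vertex_sub_eq_two_iff hk (by rwa [norm_neg]), ← h2, sub_neg_eq_add, sub_neg_eq_add,
    add_comm]

theorem norm_add_eq_two_iff {y z : X} (hy : ‖y‖ = 1) (hz : ‖z‖ = 1) :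
    ‖y + z‖ = 2 ↔ ∃ j, D.invFun z j = D.invFun y j ∧ ‖D.invFun y j‖ = 1 := by
  have hz' : ‖-z‖ = 1 := by rwa [norm_neg]
  rw [← sub_neg_eq_add, norm_sub_eq_two_iff (D := D) hy hz']
  refine exists_congr fun j => and_congr_left fun hj => ⟨fun h => ?_, fun h => ?_⟩
  · have := invFun_neg_apply (D := D) hz' (k := j) (by rw [h, norm_neg, hj])
    rw [neg_neg, h, neg_neg] at this
    exact this
  · rw [invFun_neg_apply hz (by rw [h, hj]), h]

theorem norm_add_vertex_eq_two_iff {k : ι} {c : ℂ} (hc : ‖c‖ = 1) {z : X} (hz : ‖z‖ = 1) :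
    ‖D.vertex k c + z‖ = 2 ↔ D.invFun z k = c := by
  rw [norm_add_eq_two_iff (D := D) (norm_vertex hc) hz, invFun_vertex hc]
  constructor
  · rintro ⟨j, h1, h2⟩
    obtain rfl := eq_of_pi_single_norm_eq_one h2
    rw [h1, Pi.single_eq_same]
  · intro h
    exact ⟨k, by rw [h, Pi.single_eq_same], by rw [Pi.single_eq_same, hc]⟩

theorem norm_combo_eq_one {q r : X} (hq : ‖q‖ = 1) (hr : ‖r‖ = 1) (hqr : ‖q + r‖ = 2) {a b : ℝ}
    (ha : 0 ≤ a) (hb : 0 ≤ b) (hab : a + b = 1) :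
    ‖a • q + b • r‖ = 1 ∧ ‖q + (a • q + b • r)‖ = 2 := by
  refine ⟨by rw [norm_smul_add_smul_of_norm_add_eq_two hq hr hqr ha hb, hab], ?_⟩
  have : q + (a • q + b • r) = (1 + a) • q + b • r := by module
  rw [this, norm_smul_add_smul_of_norm_add_eq_two hq hr hqr (by linarith) hb]
  linarith

/-- A convex combination shares some facet with `q`; within distance 1 of the vertex, `q` has no
unimodular coordinate other than `k`, so that facet is the given one. -/
theorem convex_facet_inter_ball (k : ι) {c : ℂ} (hc : ‖c‖ = 1) :
    Convex ℝ {y : X | (‖y‖ = 1 ∧ D.invFun y k = c) ∧ y ∈ Metric.ball (D.vertex k c) 1} := by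
  rintro q ⟨⟨hq, hqk⟩, hqb⟩ r ⟨⟨hr, hrk⟩, hrb⟩ a b ha hb hab
  have hqr : ‖q + r‖ = 2 :=
    (norm_add_eq_two_iff (D := D) hq hr).2 ⟨k, by rw [hqk, hrk], by rw [hqk, hc]⟩
  obtain ⟨h1, h2⟩ := norm_combo_eq_one hq hr hqr ha hb hab
  refine ⟨⟨h1, ?_⟩, convex_ball _ _ hqb hrb ha hb hab⟩
  obtain ⟨j, hj, hj1⟩ := (norm_add_eq_two_iff (D := D) hq h1).1 h2
  have : j = k := by
    by_contra hne
    rw [mem_ball_iff_norm, ← D.norm_invFun_sub _ _ hq (norm_vertex hc), invFun_vertex hc] at hqb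
    have h3 := norm_le_pi_norm (D.invFun q - Pi.single k c) j
    rw [Pi.sub_apply, Pi.single_eq_of_ne hne, sub_zero, hj1] at h3
    exact absurd hqb (not_lt.2 h3)
  rw [← this, hj, this, hqk]

/-! ### Supporting functionals -/

/-- A real part bound on the unit ball is a bound of the norm. -/
theorem norm_le_of_forall_re_le_one (f : X →L[ℂ] ℂ) (h : ∀ x, ‖x‖ < 1 → (f x).re ≤ 1) (x : X) :
    ‖f x‖ ≤ ‖x‖ := by
  refine le_of_forall_gt_imp_ge_of_dense fun t ht => ?_
  have ht0 : 0 < t := (norm_nonneg x).trans_lt ht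
  by_cases hfx : f x = 0
  · rw [hfx, norm_zero]; exact ht0.le
  have hfx' : (‖f x‖ : ℂ) ≠ 0 := by exact_mod_cast norm_ne_zero_iff.2 hfx
  have h1 := h (((conj (f x)) / (‖f x‖ * t)) • x) (by
    rw [norm_smul, norm_div, norm_mul, Complex.norm_real, Complex.norm_real, norm_norm,
      RCLike.norm_conj, Real.norm_of_nonneg ht0.le, div_mul_eq_div_div,
      div_self (norm_ne_zero_iff.2 hfx), one_div, ← div_eq_inv_mul, div_lt_one ht0]
    exact ht)
  have h2 : conj (f x) / (‖f x‖ * t) * f x = ((‖f x‖ / t : ℝ) : ℂ) := by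
    have : (t : ℂ) ≠ 0 := by exact_mod_cast ht0.ne'
    push_cast
    rw [div_mul_eq_mul_div, Complex.conj_mul', div_eq_div_iff (mul_ne_zero hfx' this) this]
    ring
  rw [map_smul, smul_eq_mul, h2, Complex.ofReal_re, div_le_one ht0] at h1
  exact h1

/-- Each image of a facet is supported by a contractive complex linear functional. -/
theorem exists_support (D : SphereIsometry ι X) (k : ι) {c : ℂ} (hc : ‖c‖ = 1) :
    ∃ f : X →L[ℂ] ℂ, (∀ x, ‖f x‖ ≤ ‖x‖) ∧ ∀ y, ‖y‖ = 1 → D.invFun y k = c → f y = 1 := by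
  have hp : ‖D.vertex k c‖ = 1 := norm_vertex hc
  obtain ⟨f₀, s, hs, ht⟩ := RCLike.geometric_hahn_banach_open (𝕜 := ℂ)
    (convex_ball (0 : X) 1) Metric.isOpen_ball (convex_facet_inter_ball (D := D) k hc)
    (Set.disjoint_left.2 fun y hy hy' => by
      rw [mem_ball_zero_iff, hy'.1.1] at hy; exact lt_irrefl _ hy)
  have hs0 : 0 < s := by simpa using hs 0 (Metric.mem_ball_self one_pos)
  set f : X →L[ℂ] ℂ := ((s⁻¹ : ℝ) : ℂ) • f₀ with hf
  have hre : ∀ x, (f x).re = s⁻¹ * (f₀ x).re := fun x => by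
    rw [hf, smul_apply, smul_eq_mul, Complex.re_ofReal_mul]
  have hle : ∀ x, ‖f x‖ ≤ ‖x‖ := norm_le_of_forall_re_le_one f fun x hx => by
    rw [hre, inv_mul_le_one₀ hs0]
    exact (hs x (mem_ball_zero_iff.2 hx)).le
  have hone : ∀ y, ‖y‖ = 1 → D.invFun y k = c → y ∈ Metric.ball (D.vertex k c) 1 → f y = 1 := by
    intro y hy hyk hyb
    have h1 : 1 ≤ (f y).re := by
      rw [hre, ← div_eq_inv_mul, one_le_div hs0]
      exact ht y ⟨⟨hy, hyk⟩, hyb⟩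
    have h2 := hle y
    rw [hy] at h2
    have h3 := Complex.norm_sq_eq_re_sq_add_im_sq (f y)
    have h4 : (f y).re = 1 := le_antisymm ((Complex.re_le_norm _).trans h2) h1
    rw [h4] at h3
    refine Complex.ext h4 ?_
    rw [Complex.one_im]
    nlinarith [norm_nonneg (f y)]
  refine ⟨f, hle, fun y hy hyk => ?_⟩
  have hvk : D.invFun (D.vertex k c) k = c := by rw [invFun_vertex hc, Pi.single_eq_same]
  have hpy : ‖D.vertex k c + y‖ = 2 := (norm_add_vertex_eq_two_iff hc hy).2 hyk
  -- With weight 1/4 on `y` the point is within 1/2 of the vertex, hence in the ball; `f` is 1 there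
  -- and at the vertex, so also at `y`.
  obtain ⟨h1, h2⟩ := norm_combo_eq_one hp hy hpy (a := 3 / 4) (b := 1 / 4) (by norm_num)
    (by norm_num) (by norm_num)
  have h3 := hone _ h1 ((norm_add_vertex_eq_two_iff hc h1).1 h2) (by
    have e : (3 / 4 : ℝ) • D.vertex k c + (1 / 4 : ℝ) • y - D.vertex k c
        = (1 / 4 : ℝ) • (y - D.vertex k c) := by module
    rw [mem_ball_iff_norm, e, norm_smul]
    have := norm_sub_le y (D.vertex k c)
    rw [hy, hp] at this
    norm_num
    linarith)
  have h4 := hone _ hp hvk (Metric.mem_ball_self one_pos)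
  rw [← Complex.coe_smul, ← Complex.coe_smul, map_add, map_smul, map_smul, h4, smul_eq_mul,
    smul_eq_mul] at h3
  push_cast at h3
  linear_combination 4 * h3

/-! ### Action of unimodular scalars on facets -/

theorem exists_facet_subset_smul (D : SphereIsometry ι X) {u : ℂ} (hu : ‖u‖ = 1) (k : ι) {c : ℂ}
    (hc : ‖c‖ = 1) :
    ∃ (j : ι) (d : ℂ), ‖d‖ = 1 ∧
      ∀ y, ‖y‖ = 1 → D.invFun (u • y) j = d → D.invFun y k = c := by
  have hup : ‖u • D.vertex k c‖ = 1 := by rw [norm_smul, hu, norm_vertex hc, one_mul]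
  obtain ⟨j, hj⟩ := exists_norm_apply_eq_one (D.norm_invFun _ hup)
  refine ⟨j, _, hj, fun y hy h => ?_⟩
  have huy : ‖u • y‖ = 1 := by rw [norm_smul, hu, hy, one_mul]
  have h1 := (norm_add_eq_two_iff (D := D) hup huy).2 ⟨j, h, hj⟩
  rw [← smul_add, norm_smul, hu, one_mul] at h1
  exact (norm_add_vertex_eq_two_iff hc hy).1 h1

/-- Inclusions for `u` and `u⁻¹` put one facet inside another; evaluating at its vertex shows that
they coincide. -/
theorem exists_smul_facet_eq (D : SphereIsometry ι X) {u : ℂ} (hu : ‖u‖ = 1) (k : ι) {c : ℂ}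
    (hc : ‖c‖ = 1) :
    ∃ (j : ι) (d : ℂ), ‖d‖ = 1 ∧
      ∀ y, ‖y‖ = 1 → (D.invFun (u • y) j = d ↔ D.invFun y k = c) := by
  have hu0 : u ≠ 0 := norm_ne_zero_iff.1 (by rw [hu]; exact one_ne_zero)
  obtain ⟨j, d, hd, h1⟩ := D.exists_facet_subset_smul hu k hc
  obtain ⟨l, e, he, h2⟩ := D.exists_facet_subset_smul (u := u⁻¹) (by rw [norm_inv, hu, inv_one]) j hd
  have h3 : ∀ y, ‖y‖ = 1 → D.invFun y l = e → D.invFun (u • y) j = d := fun y hy h =>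
    h2 (u • y) (by rw [norm_smul, hu, hy, one_mul]) (by rwa [inv_smul_smul₀ hu0])
  have hv : ‖D.vertex l e‖ = 1 := norm_vertex he
  have h4 := h1 _ hv (h3 _ hv (by rw [invFun_vertex he, Pi.single_eq_same]))
  rw [invFun_vertex he] at h4
  obtain rfl := eq_of_pi_single_norm_eq_one (by rw [h4, hc])
  rw [Pi.single_eq_same] at h4
  subst h4
  exact ⟨j, d, hd, fun y hy => ⟨h1 y hy, h3 y hy⟩⟩

/-- Multiplication by a unimodular scalar maps each facet to a facet in the same direction. -/
theorem exists_smul_facet_eq_same (D : SphereIsometry ι X) {u : ℂ} (hu : ‖u‖ = 1) (k : ι) {c : ℂ}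
    (hc : ‖c‖ = 1) :
    ∃ d : ℂ, ‖d‖ = 1 ∧ ∀ y, ‖y‖ = 1 → (D.invFun (u • y) k = d ↔ D.invFun y k = c) := by
  obtain ⟨j, d, hd, h⟩ := D.exists_smul_facet_eq hu k hc
  by_cases hjk : j = k
  · subst hjk
    exact ⟨d, hd, h⟩
  exfalso
  have hkj : k ≠ j := Ne.symm hjk
  -- If the direction changed, this point and its multiple by `u` would be at distance 2, so `u =
  -- -1`; but negation preserves directions.
  let x : ι → ℂ := Pi.single k c + Pi.single j (-d)
  have hxk : x k = c := by simp [x, hkj]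
  have hxj : x j = -d := by simp [x, hjk]
  have hx : ‖x‖ = 1 := by
    refine le_antisymm ((pi_norm_le_iff_of_nonneg zero_le_one).2 fun i => ?_)
      (by rw [← hc, ← hxk]; exact norm_le_pi_norm x k)
    by_cases hik : i = k
    · rw [hik, hxk, hc]
    by_cases hij : i = j
    · rw [hij, hxj, norm_neg, hd]
    · simp [x, hik, hij]
  have hy := D.norm_toFun x hx
  have huy : ‖u • D.toFun x‖ = 1 := by rw [norm_smul, hu, hy, one_mul]
  have h1 := (h _ hy).2 (by rw [D.left_inv x hx, hxk])
  have h2 : ‖u • D.toFun x - D.toFun x‖ = 2 :=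
    (norm_sub_eq_two_iff (D := D) huy hy).2 ⟨j, by rw [D.left_inv x hx, h1, hxj], by rw [h1, hd]⟩
  have h3 : u = -1 := by
    have e : u • D.toFun x - D.toFun x = (u - 1) • D.toFun x := by rw [sub_smul, one_smul]
    rw [e, norm_smul, hy, mul_one] at h2
    have h5 := congrArg (· ^ 2) h2
    have h6 := congrArg (· ^ 2) hu
    simp only [Complex.norm_sq_eq_re_sq_add_im_sq, Complex.sub_re, Complex.sub_im, Complex.one_re,
      Complex.one_im] at h5 h6
    have h7 : u.re = -1 := by nlinarith
    refine Complex.ext h7 ?_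
    rw [h7] at h6
    simp only [Complex.neg_im, Complex.one_im, neg_zero]
    nlinarith
  have hp : ‖D.vertex k c‖ = 1 := norm_vertex hc
  have h4 := (h _ hp).2 (by rw [invFun_vertex hc, Pi.single_eq_same])
  rw [h3, neg_one_smul] at h4
  have h5 := invFun_neg_apply (D := D) (y := -D.vertex k c) (by rwa [norm_neg]) (k := j)
    (by rw [h4, hd])
  rw [neg_neg, invFun_vertex hc, Pi.single_eq_of_ne hjk, h4] at h5
  have : d = 0 := by simpa using h5.symm
  rw [this, norm_zero] at hd
  exact zero_ne_one hd

/-! ### Coordinates and the linear isometry -/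

/-- Each coordinate of the inverse isometry is, up to conjugation, a contractive functional. -/
theorem exists_coordinate (D : SphereIsometry ι X) (k : ι) :
    ∃ (f : X →L[ℂ] ℂ) (σ : ℂ ≃ₗᵢ[ℝ] ℂ), (∀ x, ‖f x‖ ≤ ‖x‖) ∧
      ∀ x, ‖x‖ = 1 → f (D.toFun x) = σ (x k) := by
  obtain ⟨f, hf, hf1⟩ := D.exists_support k (c := 1) norm_one
  have hτ : ∀ u : ℂ, ∃ d : ℂ, ‖u‖ = 1 →
      ‖d‖ = 1 ∧ ∀ y, ‖y‖ = 1 → (D.invFun (u • y) k = d ↔ D.invFun y k = 1) := fun u => by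
    by_cases hu : ‖u‖ = 1
    · obtain ⟨d, hd⟩ := D.exists_smul_facet_eq_same hu k (c := 1) norm_one
      exact ⟨d, fun _ => hd⟩
    · exact ⟨0, fun h => absurd h hu⟩
  choose τ hτ using hτ
  set p := D.vertex k 1 with hp
  have hpn : ‖p‖ = 1 := norm_vertex norm_one
  have hpk : D.invFun p k = 1 := by rw [hp, invFun_vertex norm_one, Pi.single_eq_same]
  have hfu : ∀ u y, ‖u‖ = 1 → ‖y‖ = 1 → D.invFun y k = τ u → f y = u := by
    intro u y hu hy h
    have hu0 : u ≠ 0 := norm_ne_zero_iff.1 (by rw [hu]; exact one_ne_zero)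
    have hy' : ‖u⁻¹ • y‖ = 1 := by rw [norm_smul, norm_inv, hu, hy, inv_one, one_mul]
    have h1 := hf1 _ hy' (((hτ u hu).2 _ hy').1 (by rwa [smul_inv_smul₀ hu0]))
    rwa [map_smul, smul_eq_mul, inv_mul_eq_one₀ hu0, eq_comm] at h1
  have hτp : ∀ u, ‖u‖ = 1 → D.invFun (u • p) k = τ u := fun u hu => ((hτ u hu).2 p hpn).2 hpk
  have hτ1 : τ 1 = 1 := by rw [← hτp 1 norm_one, one_smul, hpk]
  have hτd : ∀ u v, ‖u‖ = 1 → ‖v‖ = 1 → ‖τ u - τ v‖ = ‖u - v‖ := by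
    intro u v hu hv
    refine le_antisymm ?_ ?_
    · have h1 := D.norm_invFun_sub (u • p) (v • p) (by rw [norm_smul, hu, hpn, one_mul])
        (by rw [norm_smul, hv, hpn, one_mul])
      rw [← sub_smul, norm_smul, hpn, mul_one] at h1
      have h2 := norm_le_pi_norm (D.invFun (u • p) - D.invFun (v • p)) k
      rwa [Pi.sub_apply, hτp u hu, hτp v hv, h1] at h2
    · have hu1 := (hτ u hu).1
      have hv1 := (hτ v hv).1
      have h1 := hfu u (D.vertex k (τ u)) hu (norm_vertex hu1)
        (by rw [invFun_vertex hu1, Pi.single_eq_same])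
      have h2 := hfu v (D.vertex k (τ v)) hv (norm_vertex hv1)
        (by rw [invFun_vertex hv1, Pi.single_eq_same])
      have h3 := hf (D.vertex k (τ u) - D.vertex k (τ v))
      rwa [map_sub, h1, h2, ← D.norm_invFun_sub _ _ (norm_vertex hu1) (norm_vertex hv1),
        invFun_vertex hu1, invFun_vertex hv1, ← Pi.single_sub, Pi.norm_single] at h3
  obtain ⟨σ, hσ⟩ : ∃ σ : ℂ ≃ₗᵢ[ℝ] ℂ, ∀ u, ‖u‖ = 1 → τ (σ u) = u := by
    rcases Complex.circle_isometry_eq_id_or_conj τ (fun u hu => (hτ u hu).1) hτd hτ1 with h | h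
    · exact ⟨LinearIsometryEquiv.refl ℝ ℂ, fun u hu => h u hu⟩
    · refine ⟨Complex.conjLIE, fun u hu => ?_⟩
      rw [Complex.conjLIE_apply, h _ (by rwa [RCLike.norm_conj]), Complex.conj_conj]
  refine ⟨f, σ, hf, fun x hx => ?_⟩
  have hgx := D.norm_toFun x hx
  have hxk : ‖x k‖ ≤ 1 := hx ▸ norm_le_pi_norm x k
  refine Complex.eq_of_forall_norm_sub_le ((hf _).trans_eq hgx) (by rwa [σ.norm_map])
    fun v hv => ?_
  obtain ⟨u, rfl⟩ := σ.surjective v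
  rw [σ.norm_map] at hv
  -- Moving only coordinate `k` gives `f (D.toFun z) = σ u` and `‖z - x‖ = ‖u - x k‖`.
  set z := Function.update x k u with hz
  have hzk : z k = u := Function.update_self _ _ _
  have hz1 : ‖z‖ = 1 := by
    refine le_antisymm ((pi_norm_le_iff_of_nonneg zero_le_one).2 fun i => ?_)
      (by rw [← hv, ← hzk]; exact norm_le_pi_norm z k)
    by_cases hik : i = k
    · rw [hik, hzk, hv]
    · rw [hz, Function.update_of_ne hik]; exact hx ▸ norm_le_pi_norm x i
  have h1 := hfu (σ u) (D.toFun z) (by rwa [σ.norm_map]) (D.norm_toFun z hz1)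
    (by rw [D.left_inv z hz1, hzk, hσ u hv])
  rw [← h1, ← map_sub, h1, ← map_sub, σ.norm_map]
  refine (hf _).trans ?_
  rw [← D.norm_invFun_sub _ _ (D.norm_toFun z hz1) hgx, D.left_inv z hz1, D.left_inv x hx]
  refine (pi_norm_le_iff_of_nonneg (norm_nonneg _)).2 fun i => ?_
  by_cases hik : i = k
  · rw [hik, Pi.sub_apply, hzk]
  · rw [Pi.sub_apply, hz, Function.update_of_ne hik, sub_self, norm_zero]
    exact norm_nonneg _

/-- A surjective isometry from the unit sphere of `ι → ℂ` onto the one of `X` is the composition of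
conjugations of some coordinates and a surjective complex linear isometry. -/
theorem exists_linearIsometryEquiv (D : SphereIsometry ι X) :
    ∃ (σ : (ι → ℂ) ≃ₗᵢ[ℝ] (ι → ℂ)) (T : X ≃ₗᵢ[ℂ] (ι → ℂ)),
      ∀ x, ‖x‖ = 1 → T (D.toFun x) = σ x := by
  choose f s _ h using D.exists_coordinate
  let σ : (ι → ℂ) ≃ₗᵢ[ℝ] (ι → ℂ) :=
    { LinearEquiv.piCongrRight fun k => (s k).toLinearEquiv with
      norm_map' := fun x => by
        have : ∀ k, ‖s k (x k)‖ = ‖x k‖ := fun k => (s k).norm_map _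
        refine le_antisymm ((pi_norm_le_iff_of_nonneg (norm_nonneg _)).2 fun k => ?_)
          ((pi_norm_le_iff_of_nonneg (norm_nonneg _)).2 fun k => ?_)
        · exact (this k).trans_le (norm_le_pi_norm x k)
        · rw [← this k]
          exact norm_le_pi_norm (fun k => s k (x k)) k }
  let T₀ : X →ₗ[ℂ] (ι → ℂ) := LinearMap.pi fun k => (f k : X →ₗ[ℂ] ℂ)
  have hT : ∀ x, ‖x‖ = 1 → T₀ (D.toFun x) = σ x := fun x hx => funext fun k => h k x hx
  have hnorm : ∀ y, ‖T₀ y‖ = ‖y‖ := by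
    intro y
    by_cases hy : y = 0
    · rw [hy, map_zero, norm_zero, norm_zero]
    have hy' : (‖y‖ : ℂ) ≠ 0 := by exact_mod_cast norm_ne_zero_iff.2 hy
    have h1 : ‖(‖y‖ : ℂ)⁻¹ • y‖ = 1 := norm_smul_inv_norm hy
    have h2 := hT _ (D.norm_invFun _ h1)
    rw [D.right_inv _ h1] at h2
    have h3 : ‖T₀ ((‖y‖ : ℂ)⁻¹ • y)‖ = 1 := by rw [h2, σ.norm_map, D.norm_invFun _ h1]
    rw [map_smul, norm_smul, norm_inv, Complex.norm_real, norm_norm,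
      inv_mul_eq_one₀ (norm_ne_zero_iff.2 hy)] at h3
    exact h3.symm
  let T₁ : X →ₗᵢ[ℂ] (ι → ℂ) := ⟨T₀, hnorm⟩
  have hsurj : Function.Surjective T₁ := by
    intro z
    by_cases hz : z = 0
    · exact ⟨0, by rw [map_zero, hz]⟩
    have hz' : (‖z‖ : ℂ) ≠ 0 := by exact_mod_cast norm_ne_zero_iff.2 hz
    have h1 : ‖(‖z‖ : ℂ)⁻¹ • z‖ = 1 := norm_smul_inv_norm hz
    obtain ⟨x, hx⟩ := σ.surjective ((‖z‖ : ℂ)⁻¹ • z)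
    have hx1 : ‖x‖ = 1 := by rw [← σ.norm_map, hx, h1]
    refine ⟨(‖z‖ : ℂ) • D.toFun x, ?_⟩
    rw [map_smul, show T₁ (D.toFun x) = σ x from hT x hx1, hx, smul_inv_smul₀ hz']
  exact ⟨σ, LinearIsometryEquiv.ofSurjective T₁ hsurj, hT⟩

omit [DecidableEq ι] [NormedSpace ℂ X] in
/-- A surjective isometry of spheres, as a pair of mutually inverse functions. -/
theorem exists_of_isometry (Δ : Metric.sphere (0 : ι → ℂ) 1 → Metric.sphere (0 : X) 1)
    (hΔ : Isometry Δ) (hs : Function.Surjective Δ) :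
    ∃ D : SphereIsometry ι X, ∀ x : Metric.sphere (0 : ι → ℂ) 1, D.toFun x = Δ x := by
  classical
  let e := Equiv.ofBijective Δ ⟨hΔ.injective, hs⟩
  let g : (ι → ℂ) → X := fun x =>
    if h : x ∈ Metric.sphere (0 : ι → ℂ) 1 then (e ⟨x, h⟩ : X) else 0
  let g' : X → (ι → ℂ) := fun y =>
    if h : y ∈ Metric.sphere (0 : X) 1 then (e.symm ⟨y, h⟩ : ι → ℂ) else 0
  have hg : ∀ x : Metric.sphere (0 : ι → ℂ) 1, g x = e x := fun x => dif_pos x.2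
  have hg' : ∀ y : Metric.sphere (0 : X) 1, g' y = e.symm y := fun y => dif_pos y.2
  have lift : ∀ x : ι → ℂ, ‖x‖ = 1 → ∃ x' : Metric.sphere (0 : ι → ℂ) 1, (x' : ι → ℂ) = x :=
    fun x hx => ⟨⟨x, mem_sphere_zero_iff_norm.2 hx⟩, rfl⟩
  have lift' : ∀ y : X, ‖y‖ = 1 → ∃ y' : Metric.sphere (0 : X) 1, (y' : X) = y :=
    fun y hy => ⟨⟨y, mem_sphere_zero_iff_norm.2 hy⟩, rfl⟩
  refine ⟨⟨g, g', fun x hx => ?_, fun y hy => ?_, fun x hx => ?_, fun y hy => ?_,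
    fun y z hy hz => ?_⟩, hg⟩
  · obtain ⟨x, rfl⟩ := lift x hx
    rw [hg]; exact mem_sphere_zero_iff_norm.1 (e x).2
  · obtain ⟨y, rfl⟩ := lift' y hy
    rw [hg']; exact mem_sphere_zero_iff_norm.1 (e.symm y).2
  · obtain ⟨x, rfl⟩ := lift x hx
    rw [hg, hg', e.symm_apply_apply]
  · obtain ⟨y, rfl⟩ := lift' y hy
    rw [hg', hg, e.apply_symm_apply]
  · obtain ⟨y, rfl⟩ := lift' y hy
    obtain ⟨z, rfl⟩ := lift' z hz
    rw [hg', hg', ← dist_eq_norm, ← dist_eq_norm, ← Subtype.dist_eq, ← Subtype.dist_eq,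
      ← hΔ.dist_eq, show Δ (e.symm y) = y from e.apply_symm_apply y,
      show Δ (e.symm z) = z from e.apply_symm_apply z]

end SphereIsometry

theorem LinearIsometryEquiv.ext_of_eq_on_sphere {Z Y : Type*} [NormedAddCommGroup Z]
    [NormedSpace ℝ Z] [NormedAddCommGroup Y] [NormedSpace ℝ Y] {F G : Z ≃ₗᵢ[ℝ] Y}
    (h : ∀ z : Metric.sphere (0 : Z) 1, F z = G z) : F = G := by
  ext z
  by_cases hz : z = 0
  · rw [hz, map_zero, map_zero]
  have h1 := h ⟨‖z‖⁻¹ • z, mem_sphere_zero_iff_norm.2 (norm_smul_inv_norm (𝕜 := ℝ) hz)⟩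
  simp only [map_smul] at h1
  exact smul_right_injective Y (inv_ne_zero (norm_ne_zero_iff.2 hz)) h1

/-- The space `Fin m → ℂ` carries the supremum norm, so it is the complex space `ℓ_∞^m`. -/
theorem mainTheorem2 (m : ℕ) :
    HasMazurUlamProperty.{0, u} (Fin m → ℂ) ∧
      ∀ (X : Type u) [NormedAddCommGroup X] [NormedSpace ℂ X] [CompleteSpace X]
        (Δ : Metric.sphere (0 : Fin m → ℂ) 1 → Metric.sphere (0 : X) 1),
        Isometry Δ → Function.Surjective Δ → Nonempty ((Fin m → ℂ) ≃ₗᵢ[ℂ] X) := by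
  refine ⟨fun Y _ _ _ Δ hΔ hs => ?_, fun X _ _ _ Δ hΔ hs => ?_⟩
  · obtain ⟨D, hD⟩ := SphereIsometry.exists_of_isometry Δ hΔ hs
    obtain ⟨σ, T, hT⟩ := D.exists_linearIsometryEquiv
    let T' : Y ≃ₗᵢ[ℝ] (Fin m → ℂ) := { T.toLinearEquiv.restrictScalars ℝ with
      norm_map' := T.norm_map }
    have hF : ∀ z : Metric.sphere (0 : Fin m → ℂ) 1, (σ.trans T'.symm) z = (Δ z : Y) := by
      intro z
      rw [LinearIsometryEquiv.trans_apply, LinearIsometryEquiv.symm_apply_eq, ← hD]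
      exact (hT z (mem_sphere_zero_iff_norm.1 z.2)).symm
    exact ⟨σ.trans T'.symm, hF, fun G hG =>
      LinearIsometryEquiv.ext_of_eq_on_sphere fun z => (hG z).trans (hF z).symm⟩
  · obtain ⟨D, -⟩ := SphereIsometry.exists_of_isometry Δ hΔ hs
    obtain ⟨-, T, -⟩ := D.exists_linearIsometryEquiv
    exact ⟨T.symm⟩
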